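/- Let ${\mathcal Y}'$ be a stationary random tessellation of the plane $\mathbb{R}^2$ with (compact) convex cells, whose cell intensity $\lambda'_{\mathsf Z}$ (the mean number of cell centroids per unit area) satisfies $0<\lambda'_{\mathsf Z}<\infty$. Every cell $z$ of ${\mathcal Y}'$ carries a mark $\rho_z\in(0,\infty)$ that is a (measurable, translation-covariant) non-random function of ${\mathcal Y}'$ viewed from $z$, and $\bar\rho_{\mathsf Z}=\mathbb{E}'_{\mathsf Z}(\rho_z)$ denotes the mean mark of the typical cell of ${\mathcal Y}'$, the expectation being taken with respect to the Palm distribution $$\mathbb{E}'_{\mathsf Z}[h]=\frac1{\lambda'_{\mathsf Z}}\,\mathbb{E}\sum_{z\in{\mathcal Y}',\ c(z)\in[0,1)^2}h({\mathcal Y}'-c(z),\,z-c(z)),\qquad c(z)=\text{centroid of }z .$$ Regard $\mathbb{R}^2$ as the horizontal plane of $\mathbb{R}^3$. For each cell $z$ of ${\mathcal Y}'$ let $\xi_z$ be a point process on the vertical line through the centroid of $z$. Given ${\mathcal Y}'$, the processes $\xi_z$ are independent, and $\xi_z$ is a stationary point process on the line with intensity $\rho_z$, whose points are unbounded in both directions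 and whose law is a translation-covariant function of $({\mathcal Y}',z)$. The column tessellation ${\mathcal Y}$ of $\mathbb{R}^3$ is obtained by cutting, for each $z$, the infinite vertical column over $z$ by the horizontal plates through the points of $\xi_z$; its cells are the right prisms $z\times[a,b]$, where $a<b$ are neighbouring points of $\xi_z$. Let $\lambda_{\mathsf Z}$ be the cell intensity of ${\mathcal Y}$ (the mean number of cell centroids per unit volume), assume $0<\lambda_{\mathsf Z}<\infty$, and let $\bar\upsilon_{\mathsf Z}$ be the mean volume of the typical cell of ${\mathcal Y}$, defined through the Palm distribution in $\mathbb{R}^3$ in the same way. Then $$\lambda_{\mathsf Z}\,\bar\upsilon_{\mathsf Z}=1\qquad\text{and}\qquad \bar\upsilon_{\mathsf Z}=\frac{1}{\lambda'_{\mathsf Z}\,\bar\rho_{\mathsf Z}} .$$ -/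

import Mathlib

open MeasureTheory ProbabilityTheory Set TopologicalSpace
open scoped ENNReal NNReal

namespace ColumnTess

/-! ### Tessellations of `ℝ^d`

The space `ℝ^d` is `Fin d → ℝ`; only its vector, topological and Lebesgue structure is used. -/

/-- The space of candidate cells: the nonempty compact subsets of `ℝ^d`. -/
abbrev Cell (d : ℕ) : Type := NonemptyCompacts (Fin d → ℝ)

/-- The Borel sets of the space of nonempty compact sets with its usual (Hausdorff) topology. -/
instance cellMeasurableSpace (d : ℕ) : MeasurableSpace (Cell d) := borel (Cell d)

instance cellBorelSpace (d : ℕ) : BorelSpace (Cell d) := ⟨rfl⟩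

/-- The translate `z + x`. -/
def Cell.translate {d : ℕ} (x : Fin d → ℝ) (z : Cell d) : Cell d :=
  z.map (fun y => y + x) (by fun_prop)

/-- The centroid (centre of mass) of a cell. -/
noncomputable def Cell.centroid {d : ℕ} (z : Cell d) : Fin d → ℝ :=
  ⨍ y in (z : Set (Fin d → ℝ)), y

/-- A tessellation of `ℝ^d` with convex cells: a locally finite collection of compact convex sets
with interior points that cover the space and have pairwise disjoint interiors. (Such cells are
automatically polytopes.) -/
@[ext]
structure Tessellation (d : ℕ) where
  cells : Set (Cell d)
  convex_cell : ∀ z ∈ cells, Convex ℝ (z : Set (Fin d → ℝ))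
  interior_nonempty : ∀ z ∈ cells, (interior (z : Set (Fin d → ℝ))).Nonempty
  locallyFinite : ∀ K : Set (Fin d → ℝ), IsCompact K →
    {z ∈ cells | ((z : Set (Fin d → ℝ)) ∩ K).Nonempty}.Finite
  covers : ∀ x : Fin d → ℝ, ∃ z ∈ cells, x ∈ z
  disjoint_interior : ∀ z ∈ cells, ∀ w ∈ cells, z ≠ w →
    Disjoint (interior (z : Set (Fin d → ℝ))) (interior (w : Set (Fin d → ℝ)))

/-- The σ-algebra on tessellations, generated by the numbers of cells belonging to a Borel set of
compact sets (a random tessellation is a point process of cells). -/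
noncomputable instance tessellationMeasurableSpace (d : ℕ) : MeasurableSpace (Tessellation d) :=
  ⨆ (B : Set (Cell d)) (_ : MeasurableSet B),
    MeasurableSpace.comap (fun φ : Tessellation d => (φ.cells ∩ B).encard) inferInstance

theorem Cell.coe_translate {d : ℕ} (x : Fin d → ℝ) (z : Cell d) :
    ((z.translate x : Cell d) : Set (Fin d → ℝ)) = Homeomorph.addRight x '' (z : Set _) := rfl

/-- The translate `φ + x` of a tessellation. -/
def Tessellation.translate {d : ℕ} (x : Fin d → ℝ) (φ : Tessellation d) : Tessellation d where
  cells := Cell.translate x '' φ.cells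
  convex_cell := by
    rintro _ ⟨z, hz, rfl⟩
    rw [Cell.coe_translate]
    have h := (φ.convex_cell z hz).translate x
    simpa [add_comm] using h
  interior_nonempty := by
    rintro _ ⟨z, hz, rfl⟩
    rw [Cell.coe_translate, ← Homeomorph.image_interior]
    exact (φ.interior_nonempty z hz).image _
  locallyFinite := by
    intro K hK
    refine ((φ.locallyFinite ((fun y => y + x) ⁻¹' K) ?_).image (Cell.translate x)).subset ?_
    · exact (Homeomorph.addRight x).isCompact_preimage.2 hK
    · rintro _ ⟨⟨z, hz, rfl⟩, y, hy, hyK⟩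
      rw [Cell.coe_translate] at hy
      obtain ⟨u, hu, rfl⟩ := hy
      exact ⟨z, ⟨hz, u, hu, hyK⟩, rfl⟩
  covers := by
    intro y
    obtain ⟨z, hz, hyz⟩ := φ.covers (y - x)
    refine ⟨z.translate x, ⟨z, hz, rfl⟩, ?_⟩
    change y ∈ ((z.translate x : Cell d) : Set _)
    rw [Cell.coe_translate]
    exact ⟨y - x, hyz, by simp⟩
  disjoint_interior := by
    rintro _ ⟨z, hz, rfl⟩ _ ⟨w, hw, rfl⟩ hne
    rw [Cell.coe_translate, Cell.coe_translate, ← Homeomorph.image_interior,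
      ← Homeomorph.image_interior]
    refine (disjoint_image_iff (Homeomorph.addRight x).injective).2
      (φ.disjoint_interior z hz w hw ?_)
    rintro rfl
    exact hne rfl

/-- The distribution of the random tessellation `X` is invariant under translations. -/
def IsStationaryTessellation {Ω : Type*} [MeasurableSpace Ω] (P : Measure Ω) {d : ℕ}
    (X : Ω → Tessellation d) : Prop :=
  ∀ (x : Fin d → ℝ) (A : Set (Tessellation d)), MeasurableSet A →
    P {ω | (X ω).translate x ∈ A} = P {ω | X ω ∈ A}

/-- The half-open unit cube `[0,1)^d`. -/
def unitCube (d : ℕ) : Set (Fin d → ℝ) := {x | ∀ i, x i ∈ Ico (0 : ℝ) 1}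

/-- The cell intensity: the mean number of cell centroids per unit volume. -/
noncomputable def cellIntensity {Ω : Type*} [MeasurableSpace Ω] (P : Measure Ω) {d : ℕ}
    (X : Ω → Tessellation d) : ℝ≥0∞ :=
  ∫⁻ ω, (({z ∈ (X ω).cells | z.centroid ∈ unitCube d}.encard : ℕ∞) : ℝ≥0∞) ∂P

/-- Expectation of `h` for the typical cell, i.e. with respect to the Palm distribution of the
stationary random tessellation `X`: the cells with centroid `c` in the unit cube are summed, the
tessellation and the cell being shifted by `-c`, and the mean is normalised by the intensity. -/
noncomputable def typicalCellMean {Ω : Type*} [MeasurableSpace Ω] (P : Measure Ω) {d : ℕ}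
    (X : Ω → Tessellation d) (h : Tessellation d → Cell d → ℝ≥0∞) : ℝ≥0∞ :=
  (cellIntensity P X)⁻¹ *
    ∫⁻ ω, ∑' z : {z : Cell d // z ∈ (X ω).cells ∧ z.centroid ∈ unitCube d},
      h ((X ω).translate (-z.1.centroid)) (z.1.translate (-z.1.centroid)) ∂P

/-- The mean volume of the typical cell. -/
noncomputable def meanCellVolume {Ω : Type*} [MeasurableSpace Ω] (P : Measure Ω) {d : ℕ}
    (X : Ω → Tessellation d) : ℝ≥0∞ :=
  typicalCellMean P X fun _ z => volume (z : Set (Fin d → ℝ))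

/-! ### Point processes on a line -/

/-- A point pattern on the line: a locally finite set of reals, unbounded in both directions. -/
@[ext]
structure LinePattern where
  points : Set ℝ
  locallyFinite : ∀ a b : ℝ, (points ∩ Icc a b).Finite
  exists_lt : ∀ t : ℝ, ∃ s ∈ points, s < t
  exists_gt : ∀ t : ℝ, ∃ s ∈ points, t < s

/-- The σ-algebra generated by the numbers of points in Borel sets. -/
noncomputable instance linePatternMeasurableSpace : MeasurableSpace LinePattern :=
  ⨆ (B : Set ℝ) (_ : MeasurableSet B),
    MeasurableSpace.comap (fun S : LinePattern => (S.points ∩ B).encard) inferInstance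

/-- The pattern shifted by `t`. -/
def LinePattern.translate (t : ℝ) (S : LinePattern) : LinePattern where
  points := (fun s => s + t) '' S.points
  locallyFinite := by
    intro a b
    refine ((S.locallyFinite (a - t) (b - t)).image (fun s => s + t)).subset ?_
    rintro _ ⟨⟨s, hs, rfl⟩, h1, h2⟩
    exact ⟨s, ⟨hs, by simp only at h1; linarith, by simp only at h2; linarith⟩, rfl⟩
  exists_lt := by
    intro u
    obtain ⟨s, hs, h⟩ := S.exists_lt (u - t)
    exact ⟨s + t, ⟨s, hs, rfl⟩, by linarith⟩
  exists_gt := by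
    intro u
    obtain ⟨s, hs, h⟩ := S.exists_gt (u - t)
    exact ⟨s + t, ⟨s, hs, rfl⟩, by linarith⟩

/-- `Q` is the law of a stationary point process on the line. -/
def IsStationaryLaw (Q : Measure LinePattern) : Prop :=
  ∀ (t : ℝ) (A : Set LinePattern), MeasurableSet A → Q {S | S.translate t ∈ A} = Q A

/-- The intensity: the mean number of points per unit length. -/
noncomputable def lineIntensity (Q : Measure LinePattern) : ℝ≥0∞ :=
  ∫⁻ S, (((S.points ∩ Ico 0 1).encard : ℕ∞) : ℝ≥0∞) ∂Q

/-! ### Column tessellations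

The base plane is spanned by the coordinates `0, 1` of `ℝ^3`; coordinate `2` is the height. -/

/-- The orthogonal projection to the base plane. -/
def basePt (x : Fin 3 → ℝ) : Fin 2 → ℝ := ![x 0, x 1]

/-- The point of height `t` above the point `y` of the base plane. -/
def liftPt (p : (Fin 2 → ℝ) × ℝ) : Fin 3 → ℝ := ![p.1 0, p.1 1, p.2]

theorem continuous_basePt : Continuous basePt := by
  refine continuous_pi fun i => ?_
  fin_cases i <;> simp [basePt] <;> fun_prop

theorem continuous_liftPt : Continuous liftPt := by
  refine continuous_pi fun i => ?_
  fin_cases i <;> simp [liftPt] <;> fun_prop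

theorem basePt_liftPt (p : (Fin 2 → ℝ) × ℝ) : basePt (liftPt p) = p.1 := by
  ext i; fin_cases i <;> simp [basePt, liftPt]

theorem height_liftPt (p : (Fin 2 → ℝ) × ℝ) : liftPt p 2 = p.2 := by simp [liftPt]

theorem liftPt_basePt (x : Fin 3 → ℝ) : liftPt (basePt x, x 2) = x := by
  ext i; fin_cases i <;> simp [basePt, liftPt]

/-- The right prism with base `z` between the heights `a ≤ b`. -/
def prism (z : Cell 2) (a b : ℝ) (hab : a ≤ b) : Cell 3 where
  carrier := liftPt '' ((z : Set (Fin 2 → ℝ)) ×ˢ Icc a b)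
  isCompact' := (z.isCompact.prod isCompact_Icc).image continuous_liftPt
  nonempty' := (z.nonempty.prod (nonempty_Icc.2 hab)).image _

theorem mem_prism {z : Cell 2} {a b : ℝ} {hab : a ≤ b} {x : Fin 3 → ℝ} :
    x ∈ (prism z a b hab : Set (Fin 3 → ℝ)) ↔ basePt x ∈ z ∧ x 2 ∈ Icc a b := by
  constructor
  · rintro ⟨p, ⟨h1, h2⟩, rfl⟩
    rw [basePt_liftPt, height_liftPt]
    exact ⟨h1, h2⟩
  · rintro ⟨h1, h2⟩
    exact ⟨(basePt x, x 2), ⟨h1, h2⟩, liftPt_basePt x⟩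

theorem interior_prism_subset {z : Cell 2} {a b : ℝ} {hab : a ≤ b} {x : Fin 3 → ℝ}
    (hx : x ∈ interior (prism z a b hab : Set (Fin 3 → ℝ))) :
    basePt x ∈ interior (z : Set (Fin 2 → ℝ)) ∧ x 2 ∈ Ioo a b := by
  have hU : IsOpen (liftPt ⁻¹' interior (prism z a b hab : Set (Fin 3 → ℝ))) :=
    isOpen_interior.preimage continuous_liftPt
  have hsub : liftPt ⁻¹' interior (prism z a b hab : Set (Fin 3 → ℝ)) ⊆
      (z : Set (Fin 2 → ℝ)) ×ˢ Icc a b := by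
    intro p hp
    have h := mem_prism.1 (interior_subset hp)
    rw [basePt_liftPt, height_liftPt] at h
    exact h
  have hmem : (basePt x, x 2) ∈ interior ((z : Set (Fin 2 → ℝ)) ×ˢ Icc a b) := by
    refine interior_maximal hsub hU ?_
    rw [mem_preimage, liftPt_basePt]
    exact hx
  rw [interior_prod_eq, interior_Icc] at hmem
  exact hmem

theorem liftPt_mem_interior_prism {z : Cell 2} {a b : ℝ} {hab : a ≤ b} {p : (Fin 2 → ℝ) × ℝ}
    (h1 : p.1 ∈ interior (z : Set (Fin 2 → ℝ))) (h2 : p.2 ∈ Ioo a b) :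
    liftPt p ∈ interior (prism z a b hab : Set (Fin 3 → ℝ)) := by
  have hU : IsOpen (basePt ⁻¹' interior (z : Set (Fin 2 → ℝ)) ∩ (fun x => x 2) ⁻¹' Ioo a b) :=
    (isOpen_interior.preimage continuous_basePt).inter
      (isOpen_Ioo.preimage (continuous_apply 2))
  refine interior_maximal (fun x hx => mem_prism.2 ⟨interior_subset hx.1, ?_⟩) hU ⟨?_, ?_⟩
  · exact Ioo_subset_Icc_self hx.2
  · simpa [basePt_liftPt] using h1
  · simpa [height_liftPt] using h2

/-- `a < b` are neighbouring points of the pattern `S`. -/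
structure Consecutive (S : LinePattern) (a b : ℝ) : Prop where
  left_mem : a ∈ S.points
  right_mem : b ∈ S.points
  lt : a < b
  gap : ∀ s ∈ S.points, ¬ (a < s ∧ s < b)

theorem exists_consecutive (S : LinePattern) (t : ℝ) :
    ∃ a b, Consecutive S a b ∧ a ≤ t ∧ t < b := by
  obtain ⟨p, hp, hpt⟩ := S.exists_lt t
  obtain ⟨q, hq, hqt⟩ := S.exists_gt t
  have hA : (S.points ∩ Icc p t).Finite := S.locallyFinite p t
  have hB : (S.points ∩ Ioc t q).Finite :=
    (S.locallyFinite t q).subset (inter_subset_inter_right _ Ioc_subset_Icc_self)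
  obtain ⟨a, ⟨haS, hpa, hat⟩, ha⟩ :=
    hA.exists_maximalFor id _ ⟨p, hp, le_refl p, hpt.le⟩
  obtain ⟨b, ⟨hbS, htb, hbq⟩, hb⟩ :=
    hB.exists_minimalFor id _ ⟨q, hq, hqt, le_refl q⟩
  refine ⟨a, b, ⟨haS, hbS, lt_of_le_of_lt hat htb, ?_⟩, hat, htb⟩
  rintro s hs ⟨h1, h2⟩
  rcases le_or_gt s t with h | h
  · exact absurd (ha (j := s) ⟨hs, hpa.trans h1.le, h⟩ h1.le) (not_le.2 h1)
  · exact absurd (hb (j := s) ⟨hs, h, h2.le.trans hbq⟩ h2.le) (not_le.2 h2)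

/-- The column tessellation over the planar tessellation `φ`: the column over the cell `z` of `φ`
is cut by horizontal plates at the heights in `S z`. -/
def columnTessellation (φ : Tessellation 2) (S : Cell 2 → LinePattern) : Tessellation 3 where
  cells := {Z | ∃ z ∈ φ.cells, ∃ a b, ∃ h : Consecutive (S z) a b, Z = prism z a b h.lt.le}
  convex_cell := by
    rintro _ ⟨z, hz, a, b, h, rfl⟩ x hx y hy s t hs ht hst
    rw [mem_prism] at hx hy ⊢
    constructor
    · have := φ.convex_cell z hz hx.1 hy.1 hs ht hst
      have e : basePt (s • x + t • y) = s • basePt x + t • basePt y := by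
        ext i; fin_cases i <;> simp [basePt]
      rw [e]
      exact this
    · exact convex_Icc a b hx.2 hy.2 hs ht hst
  interior_nonempty := by
    rintro _ ⟨z, hz, a, b, h, rfl⟩
    obtain ⟨y, hy⟩ := φ.interior_nonempty z hz
    obtain ⟨t, ht⟩ := exists_between h.lt
    exact ⟨liftPt (y, t), liftPt_mem_interior_prism hy ht⟩
  locallyFinite := by
    intro K hK
    have hK1 : IsCompact (basePt '' K) := hK.image continuous_basePt
    have hK2 : IsCompact ((fun x : Fin 3 → ℝ => x 2) '' K) := hK.image (continuous_apply 2)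
    obtain ⟨l, hl⟩ := hK2.bddBelow
    obtain ⟨u, hu⟩ := hK2.bddAbove
    choose p hp hpl using fun z => (S z).exists_lt l
    choose q hq hqu using fun z => (S z).exists_gt u
    let F : Cell 2 → Set (Cell 3) := fun z =>
      {Z | ∃ c : ℝ × ℝ, ∃ h : c.1 ≤ c.2, c ∈ ((S z).points ∩ Icc (p z) (q z)) ×ˢ
        ((S z).points ∩ Icc (p z) (q z)) ∧ Z = prism z c.1 c.2 h}
    have hF : ∀ z, (F z).Finite := by
      intro z
      have h0 := ((S z).locallyFinite (p z) (q z)).prod ((S z).locallyFinite (p z) (q z))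
      refine (h0.image fun c => if h : c.1 ≤ c.2 then prism z c.1 c.2 h else
        prism z 0 0 le_rfl).subset ?_
      rintro _ ⟨c, h, hc, rfl⟩
      exact ⟨c, hc, by simp [h]⟩
    refine ((φ.locallyFinite _ hK1).biUnion fun z _ => hF z).subset ?_
    rintro _ ⟨⟨z, hz, a, b, h, rfl⟩, x, hx, hxK⟩
    obtain ⟨hx1, hx2⟩ := mem_prism.1 hx
    have h3 : l ≤ x 2 := hl ⟨x, hxK, rfl⟩
    have h4 : x 2 ≤ u := hu ⟨x, hxK, rfl⟩
    have hpa : p z ≤ a := by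
      by_contra hc
      exact h.gap _ (hp z) ⟨not_le.1 hc, by linarith [hpl z, hx2.2]⟩
    have hbq : b ≤ q z := by
      by_contra hc
      exact h.gap _ (hq z) ⟨by linarith [hqu z, hx2.1], not_le.1 hc⟩
    refine mem_biUnion (x := z) ⟨hz, basePt x, hx1, ⟨x, hxK, rfl⟩⟩ ?_
    exact ⟨(a, b), h.lt.le, ⟨⟨h.left_mem, hpa, h.lt.le.trans hbq⟩,
      ⟨h.right_mem, hpa.trans h.lt.le, hbq⟩⟩, rfl⟩
  covers := by
    intro x
    obtain ⟨z, hz, hxz⟩ := φ.covers (basePt x)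
    obtain ⟨a, b, h, h1, h2⟩ := exists_consecutive (S z) (x 2)
    exact ⟨_, ⟨z, hz, a, b, h, rfl⟩, mem_prism.2 ⟨hxz, h1, h2.le⟩⟩
  disjoint_interior := by
    rintro _ ⟨z, hz, a, b, h, rfl⟩ _ ⟨w, hw, c, e, k, rfl⟩ hne
    rw [Set.disjoint_left]
    intro x hx hy
    obtain ⟨hx1, hx2⟩ := interior_prism_subset hx
    obtain ⟨hy1, hy2⟩ := interior_prism_subset hy
    by_cases hzw : z = w
    · subst hzw
      have e1 : a = c := by
        refine le_antisymm ?_ ?_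
        · by_contra hc
          exact k.gap a h.left_mem ⟨not_le.1 hc, hx2.1.trans hy2.2⟩
        · by_contra hc
          exact h.gap c k.left_mem ⟨not_le.1 hc, hy2.1.trans hx2.2⟩
      have e2 : b = e := by
        refine le_antisymm ?_ ?_
        · by_contra hc
          exact h.gap e k.right_mem ⟨hx2.1.trans hy2.2, not_le.1 hc⟩
        · by_contra hc
          exact k.gap b h.right_mem ⟨hy2.1.trans hx2.2, not_le.1 hc⟩
      subst e1 e2
      exact hne rfl
    · exact Set.disjoint_left.1 (φ.disjoint_interior z hz w hw hzw) hx1 hy1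

/-- Given the random planar tessellation `Y'`, the point processes `cuts · z`, for the cells `z` of
`Y'`, are independent and the one belonging to `z` has law `κ (Y', z)`. The cells of a tessellation
`φ` are listed without repetition as `label 0 φ, label 1 φ, …`, depending measurably on `φ`; only
the values of `cuts ω` at the cells of `Y' ω` matter. -/
def CondIndepCuts {Ω : Type*} [MeasurableSpace Ω] (P : Measure Ω) (Y' : Ω → Tessellation 2)
    (κ : Kernel (Tessellation 2 × Cell 2) LinePattern) (cuts : Ω → Cell 2 → LinePattern) : Prop :=
  ∃ label : ℕ → Tessellation 2 → Cell 2,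
    (∀ n, Measurable (label n)) ∧
    (∀ φ, Function.Injective (fun n => label n φ) ∧ range (fun n => label n φ) = φ.cells) ∧
    (∀ n, Measurable fun ω => cuts ω (label n (Y' ω))) ∧
    ∀ (G : Set (Tessellation 2)) (I : Finset ℕ) (A : ℕ → Set LinePattern),
      MeasurableSet G → (∀ n, MeasurableSet (A n)) →
        P {ω | Y' ω ∈ G ∧ ∀ n ∈ I, cuts ω (label n (Y' ω)) ∈ A n} =
          ∫⁻ ω in {ω | Y' ω ∈ G}, ∏ n ∈ I, κ (Y' ω, label n (Y' ω)) (A n) ∂P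

end ColumnTess

open ColumnTess

/-!
The means over the spatial tessellation are computed column by column, from the stationarity of the
planar tessellation and that of the point process on a single line.

*Reduction to columns.* A prism `z × [a, b]` has centroid `(c(z), (a + b) / 2)` and volume
`vol z * (b - a)`. Hence a sum over the prisms with centroid in the unit cube splits into a sum over
the planar cells `z` with centroid in the unit square and, for each of them, a sum over the gaps
`(a, b)` of the point process over `z` with midpoint in `[0, 1)`
(`tsum_columnTessellation_unitCube`). Given the planar tessellation, the inner sum may be replaced
by its mean under the conditional law (`CondIndepCuts.lintegral_tsum_columnTessellation`).

*One column.* For a stationary point process on the line, moving the origin shows that the mean of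
a sum over the gaps does not depend on the reference point that assigns the gaps to `[0, 1)`
(`IsStationaryLaw.lintegral_tsum_gaps`). With left end points in place of midpoints one finds that
the mean number of gaps is the intensity `ρ_z`; weighted by their lengths, they have mean total
length `1`. The sums over gaps are written as integrals over the line, which also shows that they
are measurable.

*The plane.* Moving the origin in the same way, the mean total area of the planar cells with
centroid in the unit square equals the mean total area of the intersections of all cells with that
square, which is `1` (`IsStationaryTessellation.lintegral_tsum_volume`).

Counting prisms gives `λ_Z = λ'_Z ρ̄_Z`, and adding up their volumes gives `λ_Z ῡ_Z = 1`.
-/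

namespace ColumnTess

/-! ### Measurable functions of a cell -/

/-- The membership relation between points and compact sets is closed. Through Fubini's theorem this
makes the volume and the centroid measurable functions of the cell. -/
theorem isClosed_mem_cell (d : ℕ) :
    IsClosed {p : Cell d × (Fin d → ℝ) | p.2 ∈ (p.1 : Set (Fin d → ℝ))} := by
  rw [← isOpen_compl_iff, isOpen_prod_iff]
  intro z y hy
  obtain ⟨r, hr, hsub⟩ := Metric.nhds_basis_closedBall.mem_iff.1
    (z.isCompact.isClosed.isOpen_compl.mem_nhds hy)
  refine ⟨{w : Cell d | (w : Set (Fin d → ℝ)) ⊆ (Metric.closedBall y r)ᶜ}, Metric.ball y r,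
    NonemptyCompacts.isOpen_subsets_of_isOpen Metric.isClosed_closedBall.isOpen_compl,
    Metric.isOpen_ball, subset_compl_comm.1 hsub, Metric.mem_ball_self hr, ?_⟩
  rintro ⟨w, u⟩ ⟨hw, hu⟩ huw
  exact hw huw (Metric.ball_subset_closedBall hu)

theorem measurableSet_mem_cell (d : ℕ) :
    MeasurableSet {p : Cell d × (Fin d → ℝ) | p.2 ∈ (p.1 : Set (Fin d → ℝ))} :=
  (isClosed_mem_cell d).measurableSet

theorem measurable_cell_volume (d : ℕ) :
    Measurable fun z : Cell d => volume (z : Set (Fin d → ℝ)) :=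
  measurable_measure_prodMk_left (ν := volume) (measurableSet_mem_cell d)

theorem Cell.volume_ne_top {d : ℕ} (z : Cell d) : volume (z : Set (Fin d → ℝ)) ≠ ⊤ :=
  z.isCompact.measure_lt_top.ne

theorem Cell.measurableSet {d : ℕ} (z : Cell d) : MeasurableSet (z : Set (Fin d → ℝ)) :=
  z.isCompact.isClosed.measurableSet

theorem Cell.integrableOn_id {d : ℕ} (z : Cell d) :
    IntegrableOn (fun y : Fin d → ℝ => y) (z : Set (Fin d → ℝ)) :=
  continuous_id.continuousOn.integrableOn_compact z.isCompact

theorem Cell.centroid_eq {d : ℕ} (z : Cell d) :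
    z.centroid = (volume.real (z : Set (Fin d → ℝ)))⁻¹ • ∫ y in (z : Set (Fin d → ℝ)), y :=
  setAverage_eq _ _ _

theorem Cell.centroid_apply {d : ℕ} (z : Cell d) (i : Fin d) :
    z.centroid i = (volume.real (z : Set (Fin d → ℝ)))⁻¹ * ∫ y in (z : Set (Fin d → ℝ)), y i := by
  rw [Cell.centroid_eq, Pi.smul_apply, smul_eq_mul, eval_integral]
  intro i
  exact (continuous_apply i).continuousOn.integrableOn_compact z.isCompact

theorem measurable_centroid (d : ℕ) : Measurable (Cell.centroid : Cell d → Fin d → ℝ) := by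
  have e : (Cell.centroid : Cell d → Fin d → ℝ) = fun z : Cell d =>
      (volume (z : Set (Fin d → ℝ))).toReal⁻¹ •
        ∫ y : Fin d → ℝ, {p : Cell d × (Fin d → ℝ) | p.2 ∈ (p.1 : Set (Fin d → ℝ))}.indicator
          (fun p => p.2) (z, y) := by
    funext z
    rw [Cell.centroid_eq, ← integral_indicator z.measurableSet]
    rfl
  rw [e]
  refine (measurable_cell_volume d).ennreal_toReal.inv.smul ?_
  refine StronglyMeasurable.measurable ?_
  refine StronglyMeasurable.integral_prod_right (f := fun (z : Cell d) (y : Fin d → ℝ) =>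
    {p : Cell d × (Fin d → ℝ) | p.2 ∈ (p.1 : Set (Fin d → ℝ))}.indicator (fun p => p.2) (z, y)) ?_
  exact (measurable_snd.indicator (measurableSet_mem_cell d)).stronglyMeasurable

theorem continuous_cell_translate {d : ℕ} :
    Continuous fun p : (Fin d → ℝ) × Cell d => Cell.translate p.1 p.2 :=
  Continuous.nonemptyCompacts_map' (by fun_prop) (by fun_prop)

theorem Cell.mem_translate {d : ℕ} {x y : Fin d → ℝ} {z : Cell d} :
    y ∈ (z.translate x : Set (Fin d → ℝ)) ↔ y - x ∈ (z : Set (Fin d → ℝ)) := by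
  rw [Cell.coe_translate]
  constructor
  · rintro ⟨u, hu, rfl⟩
    simpa using hu
  · intro h
    exact ⟨y - x, h, by simp⟩

theorem Cell.coe_translate_eq_preimage {d : ℕ} (x : Fin d → ℝ) (z : Cell d) :
    (z.translate x : Set (Fin d → ℝ)) = (fun y => y + -x) ⁻¹' (z : Set (Fin d → ℝ)) := by
  ext y
  rw [Cell.mem_translate, sub_eq_add_neg]
  rfl

theorem Cell.volume_translate {d : ℕ} (x : Fin d → ℝ) (z : Cell d) :
    volume (z.translate x : Set (Fin d → ℝ)) = volume (z : Set (Fin d → ℝ)) := by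
  rw [Cell.coe_translate_eq_preimage, measure_preimage_add_right]

theorem Cell.translate_injective {d : ℕ} (x : Fin d → ℝ) :
    Function.Injective (Cell.translate x) := by
  intro z w h
  refine SetLike.coe_injective ((Homeomorph.addRight x).injective.image_injective ?_)
  rw [← Cell.coe_translate, ← Cell.coe_translate, h]

theorem Cell.volume_pos {d : ℕ} {z : Cell d} (hz : (interior (z : Set (Fin d → ℝ))).Nonempty) :
    0 < volume (z : Set (Fin d → ℝ)) :=
  Measure.measure_pos_of_nonempty_interior _ hz

theorem Cell.volume_real_pos {d : ℕ} {z : Cell d}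
    (hz : (interior (z : Set (Fin d → ℝ))).Nonempty) :
    0 < volume.real (z : Set (Fin d → ℝ)) :=
  ENNReal.toReal_pos (Cell.volume_pos hz).ne' z.volume_ne_top

/-- The centroid is translation covariant on cells of positive volume; on null sets it is the junk
value `0`. -/
theorem Cell.centroid_translate {d : ℕ} (x : Fin d → ℝ) {z : Cell d}
    (hz : (interior (z : Set (Fin d → ℝ))).Nonempty) :
    (z.translate x).centroid = z.centroid + x := by
  have hv : volume.real (z.translate x : Set (Fin d → ℝ)) = volume.real (z : Set (Fin d → ℝ)) := by
    rw [Measure.real, Cell.volume_translate, Measure.real]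
  have hi : ∫ y in (z.translate x : Set (Fin d → ℝ)), y =
      ∫ y in (z : Set (Fin d → ℝ)), (y + x) := by
    rw [Cell.coe_translate]
    exact (measurePreserving_add_right volume x).setIntegral_image_emb
      (Homeomorph.addRight x).measurableEmbedding (fun y => y) _
  rw [Cell.centroid_eq, hv, hi, integral_add z.integrableOn_id
    (integrableOn_const z.volume_ne_top), setIntegral_const, smul_add, smul_smul,
    inv_mul_cancel₀ (Cell.volume_real_pos hz).ne', one_smul, ← Cell.centroid_eq]

theorem measurableSet_unitCube (d : ℕ) : MeasurableSet (unitCube d) := by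
  have : unitCube d = ⋂ i, (fun x : Fin d → ℝ => x i) ⁻¹' Ico 0 1 := by
    ext x; simp [unitCube]
  rw [this]
  exact MeasurableSet.iInter fun i => measurableSet_Ico.preimage (measurable_pi_apply i)

theorem volume_unitCube (d : ℕ) : volume (unitCube d) = 1 := by
  have : unitCube d = Set.pi univ fun _ => Ico (0 : ℝ) 1 := by
    ext x; simp [unitCube]
  rw [this, Real.volume_pi_Ico]
  simp

/-! ### Stationary tessellations and translation of the origin -/

/-- A measurable enumeration without repetition of the cells of a tessellation. -/
structure IsLabelling {d : ℕ} (label : ℕ → Tessellation d → Cell d) : Prop where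
  measurable : ∀ n, Measurable (label n)
  injective : ∀ φ, Function.Injective fun n => label n φ
  range_eq : ∀ φ, range (fun n => label n φ) = φ.cells

namespace IsLabelling

variable {d : ℕ} {label : ℕ → Tessellation d → Cell d}

theorem tsum_cells (hl : IsLabelling label) (φ : Tessellation d) (f : Cell d → ℝ≥0∞) :
    ∑' z : φ.cells, f z = ∑' n, f (label n φ) := by
  rw [← hl.range_eq φ]
  exact tsum_range f (hl.injective φ)

theorem measurable_tsum_cells (hl : IsLabelling label) {f : Cell d → ℝ≥0∞} (hf : Measurable f) :
    Measurable fun φ : Tessellation d => ∑' z : φ.cells, f z := by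
  simp_rw [hl.tsum_cells]
  exact Measurable.tsum fun n => hf.comp (hl.measurable n)

end IsLabelling

theorem measurable_cell_translate {d : ℕ} (x : Fin d → ℝ) :
    Measurable (Cell.translate x : Cell d → Cell d) :=
  (continuous_cell_translate.comp (Continuous.prodMk_right x)).measurable

theorem measurable_encard_cells_inter {d : ℕ} {B : Set (Cell d)} (hB : MeasurableSet B) :
    Measurable fun φ : Tessellation d => (φ.cells ∩ B).encard :=
  measurable_iff_comap_le.2 (le_iSup₂_of_le B hB le_rfl)

theorem measurable_tessellation_translate {d : ℕ} (x : Fin d → ℝ) :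
    Measurable (Tessellation.translate x : Tessellation d → Tessellation d) := by
  rw [measurable_iff_le_map]
  refine iSup₂_le fun B hB => MeasurableSpace.comap_le_iff_le_map.2 fun s hs => ?_
  have h : (fun φ : Tessellation d => ((φ.translate x).cells ∩ B).encard) =
      fun φ => (φ.cells ∩ Cell.translate x ⁻¹' B).encard := funext fun φ => by
    change (Cell.translate x '' φ.cells ∩ B).encard = _
    rw [← image_inter_preimage, (Cell.translate_injective x).encard_image]
  have hm := measurable_encard_cells_inter (measurable_cell_translate x hB)
  rw [← h] at hm
  exact hm hs

theorem tsum_cells_translate {d : ℕ} (x : Fin d → ℝ) (φ : Tessellation d)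
    (f : Cell d → ℝ≥0∞) :
    ∑' z : (φ.translate x).cells, f z = ∑' z : φ.cells, f ((z : Cell d).translate x) :=
  tsum_image f (Cell.translate_injective x).injOn

section

variable {Ω : Type*} [MeasurableSpace Ω] {P : Measure Ω} {d : ℕ} {X : Ω → Tessellation d}
  {label : ℕ → Tessellation d → Cell d}

theorem IsStationaryTessellation.lintegral_tsum_translate (hs : IsStationaryTessellation P X)
    (hX : Measurable X) (hl : IsLabelling label) {f : Cell d → ℝ≥0∞} (hf : Measurable f)
    (x : Fin d → ℝ) :
    ∫⁻ ω, ∑' z : (X ω).cells, f ((z : Cell d).translate x) ∂P =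
      ∫⁻ ω, ∑' z : (X ω).cells, f z ∂P := by
  have hT := measurable_tessellation_translate (d := d) x
  have hm : P.map (fun ω => (X ω).translate x) = P.map X := by
    ext A hA
    rw [Measure.map_apply (f := fun ω => (X ω).translate x) (hT.comp hX) hA,
      Measure.map_apply hX hA]
    exact hs x A hA
  have hF := hl.measurable_tsum_cells hf
  rw [← lintegral_map (f := fun φ : Tessellation d => ∑' z : φ.cells, f z) hF hX, ← hm,
    lintegral_map (g := fun ω => (X ω).translate x) hF (hT.comp hX)]
  simp_rw [tsum_cells_translate]

/-- Integrating over each cell and then averaging amounts to looking at the cells that contain the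
origin: the point of integration is moved to the origin by stationarity. -/
theorem IsStationaryTessellation.lintegral_tsum_setLIntegral [SFinite P]
    (hs : IsStationaryTessellation P X)
    (hX : Measurable X) (hl : IsLabelling label) {g : Cell d → (Fin d → ℝ) → ℝ≥0∞}
    (hg : Measurable fun p : Cell d × (Fin d → ℝ) => g p.1 p.2) :
    ∫⁻ ω, (∑' z : (X ω).cells, ∫⁻ t in ((z : Cell d) : Set (Fin d → ℝ)), g z t) ∂P =
      ∫⁻ ω, ∑' z : (X ω).cells, {z : Cell d | (0 : Fin d → ℝ) ∈ z}.indicator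
        (fun z => ∫⁻ t, g (z.translate t) t) z ∂P := by
  let G : Cell d × (Fin d → ℝ) → ℝ≥0∞ :=
    {p : Cell d × (Fin d → ℝ) | p.2 ∈ (p.1 : Set (Fin d → ℝ))}.indicator fun p => g p.1 p.2
  have hG : Measurable G := hg.indicator (measurableSet_mem_cell d)
  have h1 : ∀ z : Cell d, ∫⁻ t in (z : Set (Fin d → ℝ)), g z t = ∫⁻ t, G (z, t) := fun z => by
    rw [← lintegral_indicator z.measurableSet]
    rfl
  have h2 : ∀ z : Cell d, {z : Cell d | (0 : Fin d → ℝ) ∈ z}.indicator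
      (fun z => ∫⁻ t, g (z.translate t) t) z = ∫⁻ t, G (z.translate t, t) := fun z => by
    by_cases h : (0 : Fin d → ℝ) ∈ z
    · rw [indicator_of_mem (by exact h)]
      refine lintegral_congr fun t => ?_
      exact (indicator_of_mem (by
        change t ∈ (z.translate t : Set (Fin d → ℝ))
        rwa [Cell.mem_translate, sub_self]) _).symm
    · rw [indicator_of_notMem (by exact h), eq_comm]
      refine (lintegral_congr fun t => ?_).trans lintegral_zero
      exact indicator_of_notMem (by
        change t ∉ (z.translate t : Set (Fin d → ℝ))
        rwa [Cell.mem_translate, sub_self]) _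
  have hT : Measurable fun p : Cell d × (Fin d → ℝ) => (p.1.translate p.2, p.2) :=
    (continuous_cell_translate.comp continuous_swap).measurable.prodMk measurable_snd
  -- Tonelli for a sum over the cells and an integral over the points
  have key : ∀ H : Cell d × (Fin d → ℝ) → ℝ≥0∞, Measurable H →
      ∫⁻ ω, (∑' z : (X ω).cells, ∫⁻ t, H (z, t)) ∂P =
        ∫⁻ t, ∫⁻ ω, ∑' z : (X ω).cells, H (z, t) ∂P := fun H hH => by
    have hm : ∀ n, Measurable fun q : Ω × (Fin d → ℝ) => H (label n (X q.1), q.2) := fun n =>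
      hH.comp (((hl.measurable n).comp (hX.comp measurable_fst)).prodMk measurable_snd)
    rw [lintegral_lintegral_swap]
    · refine lintegral_congr fun ω => ?_
      rw [hl.tsum_cells (X ω) fun z => ∫⁻ t, H (z, t), ← lintegral_tsum]
      · refine lintegral_congr fun t => ?_
        rw [hl.tsum_cells (X ω) fun z => H (z, t)]
      · exact fun n => ((hm n).comp measurable_prodMk_left).aemeasurable
    · refine Measurable.aemeasurable ?_
      have e : (Function.uncurry fun (t : Fin d → ℝ) ω => ∑' z : (X ω).cells, H (z, t)) =
          fun q => ∑' n, H (label n (X q.2), q.1) :=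
        funext fun q => hl.tsum_cells (X q.2) fun z => H (z, q.1)
      rw [e]
      exact Measurable.tsum fun n => (hm n).comp measurable_swap
  simp_rw [h1, h2]
  refine (key G hG).trans (Eq.trans ?_
    (key (fun p => G (p.1.translate p.2, p.2)) (hG.comp hT)).symm)
  refine lintegral_congr fun t => ?_
  exact (IsStationaryTessellation.lintegral_tsum_translate hs hX hl
    (hG.comp measurable_prodMk_right) t).symm

/-- Distinct cells overlap only in their frontiers, which are null sets by convexity. -/
theorem Tessellation.tsum_volume_inter (φ : Tessellation d) {A : Set (Fin d → ℝ)}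
    (hA : MeasurableSet A) [Countable φ.cells] :
    ∑' z : φ.cells, volume (((z : Cell d) : Set (Fin d → ℝ)) ∩ A) = volume A := by
  rw [← measure_iUnion₀]
  · congr 1
    rw [← iUnion_inter, inter_eq_right]
    intro x _
    obtain ⟨z, hz, hx⟩ := φ.covers x
    exact mem_iUnion.2 ⟨⟨z, hz⟩, hx⟩
  · intro z w hzw
    refine AEDisjoint.mono ?_ inter_subset_left inter_subset_left
    refine measure_mono_null (t := frontier ((z : Cell d) : Set (Fin d → ℝ)) ∪
      frontier ((w : Cell d) : Set (Fin d → ℝ))) ?_ ?_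
    · rintro x ⟨hxz, hxw⟩
      by_contra hx
      rw [mem_union, not_or] at hx
      have hd := φ.disjoint_interior z z.2 w w.2 fun h => hzw (Subtype.ext h)
      refine Set.disjoint_left.1 hd (?_ : x ∈ _) ?_
      · by_contra h
        exact hx.1 ⟨subset_closure hxz, h⟩
      · by_contra h
        exact hx.2 ⟨subset_closure hxw, h⟩
    · exact measure_union_null ((φ.convex_cell z z.2).addHaar_frontier volume)
        ((φ.convex_cell w w.2).addHaar_frontier volume)
  · exact fun z => ((z : Cell d).measurableSet.inter hA).nullMeasurableSet

/-- In a stationary tessellation, the cells with centroid in the unit cube have mean total volume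
`1`. -/
theorem IsStationaryTessellation.lintegral_tsum_volume [IsProbabilityMeasure P]
    (hs : IsStationaryTessellation P X) (hX : Measurable X) (hl : IsLabelling label) :
    ∫⁻ ω, ∑' z : (X ω).cells, {z : Cell d | z.centroid ∈ unitCube d}.indicator
      (fun z => volume (z : Set (Fin d → ℝ))) z ∂P = 1 := by
  have hU := measurableSet_unitCube d
  -- the total volume and `∑ vol (z ∩ unitCube) = 1` both have as mean the mean number of cells
  -- that contain the origin
  have h1 := IsStationaryTessellation.lintegral_tsum_setLIntegral hs hX hl
    (g := fun z _ => (unitCube d).indicator 1 z.centroid)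
    ((measurable_one.indicator hU).comp ((measurable_centroid d).comp measurable_fst))
  have h2 := IsStationaryTessellation.lintegral_tsum_setLIntegral hs hX hl
    (g := fun _ t => (unitCube d).indicator 1 t)
    ((measurable_one.indicator hU).comp measurable_snd)
  have e1 : ∀ ω, ∀ z : (X ω).cells, ∫⁻ t, (unitCube d).indicator (1 : (Fin d → ℝ) → ℝ≥0∞)
      (((z : Cell d).translate t).centroid) =
        ∫⁻ t, (unitCube d).indicator (1 : (Fin d → ℝ) → ℝ≥0∞) t := by
    intro ω z
    simp_rw [Cell.centroid_translate _ ((X ω).interior_nonempty z z.2)]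
    rw [lintegral_add_left_eq_self]
  have h3 : ∀ ω, ∑' z : (X ω).cells, ∫⁻ t in ((z : Cell d) : Set (Fin d → ℝ)),
      (unitCube d).indicator (1 : (Fin d → ℝ) → ℝ≥0∞) t = 1 := by
    intro ω
    have : Countable (X ω).cells := by
      rw [← hl.range_eq]
      exact (countable_range _).to_subtype
    simp_rw [lintegral_indicator_one hU, Measure.restrict_apply hU]
    simp_rw [inter_comm (unitCube d)]
    rw [(X ω).tsum_volume_inter hU, volume_unitCube]
  have h4 : ∀ z : Cell d, {z : Cell d | z.centroid ∈ unitCube d}.indicator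
      (fun z => volume (z : Set (Fin d → ℝ))) z =
        ∫⁻ _ in (z : Set (Fin d → ℝ)),
          (unitCube d).indicator (1 : (Fin d → ℝ) → ℝ≥0∞) z.centroid := by
    intro z
    rw [setLIntegral_const]
    by_cases h : z.centroid ∈ unitCube d
    · rw [indicator_of_mem (by exact h), indicator_of_mem h]
      simp
    · rw [indicator_of_notMem (by exact h), indicator_of_notMem h, zero_mul]
  simp_rw [h4]
  rw [h1]
  simp_rw [h3, lintegral_one, measure_univ] at h2
  rw [h2]
  refine lintegral_congr fun ω => tsum_congr fun z => ?_
  by_cases h : (0 : Fin d → ℝ) ∈ (z : Cell d)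
  · rw [indicator_of_mem (by exact h), indicator_of_mem (by exact h), e1]
  · rw [indicator_of_notMem (by exact h), indicator_of_notMem (by exact h)]

end

/-! ### Gaps of a point pattern on the line -/

namespace LinePattern

/-- The last point of the pattern `S` that is at most `t`. -/
noncomputable def lastLE (S : LinePattern) (t : ℝ) : ℝ :=
  (exists_consecutive S t).choose

/-- The first point of the pattern `S` that exceeds `t`. -/
noncomputable def firstGT (S : LinePattern) (t : ℝ) : ℝ :=
  (exists_consecutive S t).choose_spec.choose

theorem consecutive_lastLE_firstGT (S : LinePattern) (t : ℝ) :
    Consecutive S (S.lastLE t) (S.firstGT t) :=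
  (exists_consecutive S t).choose_spec.choose_spec.1

theorem lastLE_le (S : LinePattern) (t : ℝ) : S.lastLE t ≤ t :=
  (exists_consecutive S t).choose_spec.choose_spec.2.1

theorem lt_firstGT (S : LinePattern) (t : ℝ) : t < S.firstGT t :=
  (exists_consecutive S t).choose_spec.choose_spec.2.2

theorem _root_.ColumnTess.Consecutive.eq_of_mem_Ico {S : LinePattern} {a b a' b' t : ℝ}
    (h : Consecutive S a b)
    (h' : Consecutive S a' b') (ht : t ∈ Ico a b) (ht' : t ∈ Ico a' b') : a = a' ∧ b = b' := by
  refine ⟨le_antisymm ?_ ?_, le_antisymm ?_ ?_⟩ <;> by_contra hc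
  · exact h'.gap a h.left_mem ⟨not_le.1 hc, ht.1.trans_lt ht'.2⟩
  · exact h.gap a' h'.left_mem ⟨not_le.1 hc, ht'.1.trans_lt ht.2⟩
  · exact h.gap b' h'.right_mem ⟨ht.1.trans_lt ht'.2, not_le.1 hc⟩
  · exact h'.gap b h.right_mem ⟨ht'.1.trans_lt ht.2, not_le.1 hc⟩

theorem lastLE_eq_and_firstGT_eq {S : LinePattern} {a b t : ℝ} (h : Consecutive S a b)
    (ht : t ∈ Ico a b) : S.lastLE t = a ∧ S.firstGT t = b :=
  (S.consecutive_lastLE_firstGT t).eq_of_mem_Ico h ⟨S.lastLE_le t, S.lt_firstGT t⟩ ht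

theorem _root_.ColumnTess.Consecutive.translate {S : LinePattern} {a b : ℝ} (h : Consecutive S a b)
    (x : ℝ) : Consecutive (S.translate x) (a + x) (b + x) where
  left_mem := ⟨a, h.left_mem, rfl⟩
  right_mem := ⟨b, h.right_mem, rfl⟩
  lt := by linarith [h.lt]
  gap := by
    rintro _ ⟨s, hs, rfl⟩ ⟨h1, h2⟩
    exact h.gap s hs ⟨by linarith, by linarith⟩

theorem translate_lastLE_firstGT (S : LinePattern) (x t : ℝ) :
    (S.translate x).lastLE (t + x) = S.lastLE t + x ∧
      (S.translate x).firstGT (t + x) = S.firstGT t + x :=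
  lastLE_eq_and_firstGT_eq ((S.consecutive_lastLE_firstGT t).translate x)
    ⟨by linarith [S.lastLE_le t], by linarith [S.lt_firstGT t]⟩

/-- Restricting to rational `r` expresses the event through countably many counts of points, which
gives joint measurability in `S` and `t`; likewise for `lastLE_lt_iff`. -/
theorem lt_firstGT_iff (S : LinePattern) (t u : ℝ) :
    u < S.firstGT t ↔ ∀ r : ℚ, (r : ℝ) ≤ t ∨ S.points ∩ Icc (r : ℝ) u = ∅ := by
  have hc := S.consecutive_lastLE_firstGT t
  constructor
  · intro h r
    refine or_iff_not_imp_left.2 fun hr => eq_empty_of_forall_notMem ?_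
    rintro s ⟨hs, hrs, hsu⟩
    exact hc.gap s hs ⟨by linarith [S.lastLE_le t, not_le.1 hr], hsu.trans_lt h⟩
  · intro h
    by_contra hu
    obtain ⟨r, hr, hr'⟩ := exists_rat_btwn (S.lt_firstGT t)
    rcases h r with h | h
    · exact absurd hr (not_lt.2 h)
    · exact (h.subset ⟨hc.right_mem, hr'.le, not_lt.1 hu⟩).elim

theorem lastLE_lt_iff (S : LinePattern) (t u : ℝ) :
    S.lastLE t < u ↔ ∃ r : ℚ, t < r ∧ S.points ∩ Icc u (r : ℝ) = ∅ := by
  have hc := S.consecutive_lastLE_firstGT t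
  constructor
  · intro h
    obtain ⟨r, hr, hr'⟩ := exists_rat_btwn (S.lt_firstGT t)
    refine ⟨r, hr, eq_empty_of_forall_notMem ?_⟩
    rintro s ⟨hs, hus, hsr⟩
    exact hc.gap s hs ⟨h.trans_le hus, hsr.trans_lt hr'⟩
  · rintro ⟨r, hr, h⟩
    by_contra hu
    exact (h.subset ⟨hc.left_mem, not_lt.1 hu, (S.lastLE_le t).trans hr.le⟩).elim

theorem measurable_encard_points_inter {B : Set ℝ} (hB : MeasurableSet B) :
    Measurable fun S : LinePattern => (S.points ∩ B).encard :=
  measurable_iff_comap_le.2 (le_iSup₂_of_le B hB le_rfl)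

theorem measurableSet_points_inter_eq_empty {B : Set ℝ} (hB : MeasurableSet B) :
    MeasurableSet {S : LinePattern | S.points ∩ B = ∅} := by
  simp_rw [← encard_eq_zero]
  exact measurable_encard_points_inter hB (measurableSet_singleton 0)

theorem measurable_translate (x : ℝ) : Measurable (LinePattern.translate x) := by
  rw [measurable_iff_le_map]
  refine iSup₂_le fun B hB => MeasurableSpace.comap_le_iff_le_map.2 fun s hs => ?_
  have h : (fun S : LinePattern => ((S.translate x).points ∩ B).encard) =
      fun S => (S.points ∩ (fun s => s + x) ⁻¹' B).encard := funext fun S => by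
    change ((fun s => s + x) '' S.points ∩ B).encard = _
    rw [← image_inter_preimage, (add_left_injective x).encard_image]
  have hm := measurable_encard_points_inter (measurable_add_const x hB)
  rw [← h] at hm
  exact hm hs

theorem measurable_lastLE : Measurable fun q : LinePattern × ℝ => q.1.lastLE q.2 := by
  refine measurable_of_Iio fun u => ?_
  have e : (fun q : LinePattern × ℝ => q.1.lastLE q.2) ⁻¹' Iio u =
      ⋃ r : ℚ, {S : LinePattern | S.points ∩ Icc u (r : ℝ) = ∅} ×ˢ Iio (r : ℝ) := by
    ext q
    simp only [mem_preimage, mem_Iio, lastLE_lt_iff, mem_iUnion, mem_prod, mem_ofPred_eq]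
    exact exists_congr fun r => and_comm
  rw [e]
  exact MeasurableSet.iUnion fun r =>
    (measurableSet_points_inter_eq_empty measurableSet_Icc).prod measurableSet_Iio

theorem measurable_firstGT : Measurable fun q : LinePattern × ℝ => q.1.firstGT q.2 := by
  refine measurable_of_Ioi fun u => ?_
  have e : (fun q : LinePattern × ℝ => q.1.firstGT q.2) ⁻¹' Ioi u =
      ⋂ r : ℚ, Prod.snd ⁻¹' Ici (r : ℝ) ∪
        Prod.fst ⁻¹' {S : LinePattern | S.points ∩ Icc (r : ℝ) u = ∅} := by
    ext q
    simp only [mem_preimage, mem_Ioi, lt_firstGT_iff, mem_iInter, mem_union, mem_Ici, mem_ofPred_eq]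
  rw [e]
  exact MeasurableSet.iInter fun r => (measurableSet_Ici.preimage measurable_snd).union
    ((measurableSet_points_inter_eq_empty measurableSet_Icc).preimage measurable_fst)

theorem countable_points (S : LinePattern) : S.points.Countable := by
  have h : S.points = ⋃ n : ℕ, S.points ∩ Icc (-(n : ℝ)) n := by
    rw [← inter_iUnion, eq_comm, inter_eq_left]
    intro x _
    obtain ⟨n, hn⟩ := exists_nat_ge |x|
    exact mem_iUnion.2 ⟨n, abs_le.1 hn⟩
  rw [h]
  exact countable_iUnion fun n => (S.locallyFinite _ _).countable

/-- The gaps of the pattern `S`, as pairs of neighbouring points. -/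
def gaps (S : LinePattern) : Set (ℝ × ℝ) := {c | Consecutive S c.1 c.2}

theorem consecutive_gap {S : LinePattern} (c : S.gaps) :
    Consecutive S (c : ℝ × ℝ).1 (c : ℝ × ℝ).2 :=
  c.2

theorem countable_gaps (S : LinePattern) : S.gaps.Countable :=
  (S.countable_points.prod S.countable_points).mono fun _ hc => mk_mem_prod hc.left_mem hc.right_mem

/-- A sum over the gaps is an integral over the line, in which each gap is weighted by the inverse
of its length. -/
theorem tsum_gaps (S : LinePattern) (f : ℝ × ℝ → ℝ≥0∞) :
    ∑' c : S.gaps, f c =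
      ∫⁻ t, f (S.lastLE t, S.firstGT t) / ENNReal.ofReal (S.firstGT t - S.lastLE t) := by
  have : Countable S.gaps := S.countable_gaps.to_subtype
  have hU : ⋃ c : S.gaps, Ico (c : ℝ × ℝ).1 (c : ℝ × ℝ).2 = univ := eq_univ_of_forall fun t =>
    mem_iUnion.2 ⟨⟨(S.lastLE t, S.firstGT t), S.consecutive_lastLE_firstGT t⟩,
      S.lastLE_le t, S.lt_firstGT t⟩
  rw [← setLIntegral_univ, ← hU, lintegral_iUnion (fun _ => measurableSet_Ico)]
  · refine tsum_congr fun c => ?_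
    have hpos : 0 < (c : ℝ × ℝ).2 - (c : ℝ × ℝ).1 := sub_pos.2 c.2.lt
    rw [setLIntegral_congr_fun (g := fun _ => f c / ENNReal.ofReal ((c : ℝ × ℝ).2 - (c : ℝ × ℝ).1))
      measurableSet_Ico, setLIntegral_const, Real.volume_Ico,
      ENNReal.div_mul_cancel (ENNReal.ofReal_pos.2 hpos).ne' ENNReal.ofReal_ne_top]
    intro t ht
    obtain ⟨h1, h2⟩ := lastLE_eq_and_firstGT_eq c.2 ht
    simp only [h1, h2]
  · intro c c' hne
    refine Set.disjoint_left.2 fun t ht ht' => hne ?_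
    obtain ⟨h1, h2⟩ := c.2.eq_of_mem_Ico c'.2 ht ht'
    exact Subtype.ext (Prod.ext h1 h2)

theorem measurable_gap_integrand {f : ℝ × ℝ → ℝ≥0∞} (hf : Measurable f) :
    Measurable fun q : LinePattern × ℝ => f (q.1.lastLE q.2, q.1.firstGT q.2) /
      ENNReal.ofReal (q.1.firstGT q.2 - q.1.lastLE q.2) :=
  (hf.comp (measurable_lastLE.prodMk measurable_firstGT)).div
    (measurable_firstGT.sub measurable_lastLE).ennreal_ofReal

theorem measurable_tsum_gaps {f : ℝ × ℝ → ℝ≥0∞} (hf : Measurable f) :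
    Measurable fun S : LinePattern => ∑' c : S.gaps, f c := by
  simp_rw [tsum_gaps]
  exact (measurable_gap_integrand hf).lintegral_prod_right'

/-- The points of the pattern are counted as left end points of gaps. -/
theorem encard_points_inter (S : LinePattern) (B : Set ℝ) :
    (((S.points ∩ B).encard : ℕ∞) : ℝ≥0∞) =
      ∑' c : S.gaps, (Prod.fst ⁻¹' B).indicator 1 (c : ℝ × ℝ) := by
  let e : S.gaps → S.points := fun c => ⟨(c : ℝ × ℝ).1, c.2.left_mem⟩
  have he : Function.Bijective e := by
    constructor
    · intro c c' h
      have h1 : (c : ℝ × ℝ).1 = (c' : ℝ × ℝ).1 := congrArg Subtype.val h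
      have := c.2.eq_of_mem_Ico c'.2 (left_mem_Ico.2 c.2.lt)
        (by rw [h1]; exact left_mem_Ico.2 c'.2.lt)
      exact Subtype.ext (Prod.ext this.1 this.2)
    · rintro ⟨a, ha⟩
      have hc := S.consecutive_lastLE_firstGT a
      refine ⟨⟨(a, S.firstGT a), ?_⟩, rfl⟩
      have : S.lastLE a = a := by
        refine (S.lastLE_le a).antisymm (not_lt.1 fun h => hc.gap a ha ⟨h, S.lt_firstGT a⟩)
      rw [this] at hc
      exact hc
  rw [← ENNReal.tsum_set_one, tsum_subtype (S.points ∩ B) fun _ => (1 : ℝ≥0∞),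
    ← indicator_indicator, ← tsum_subtype, ← (Equiv.ofBijective e he).tsum_eq]
  rfl

end LinePattern

/-! ### Stationary point processes on the line -/

variable {Q : Measure LinePattern}

theorem IsStationaryLaw.map_translate (hQ : IsStationaryLaw Q) (x : ℝ) :
    Q.map (LinePattern.translate x) = Q := by
  ext A hA
  rw [Measure.map_apply (LinePattern.measurable_translate x) hA]
  exact hQ x A hA

/-- The mean of a sum over the gaps that have a reference point (such as the midpoint) in the unit
interval is a mean over the gap at the origin. In particular it does not depend on the reference
point. -/
theorem IsStationaryLaw.lintegral_tsum_gaps [SFinite Q] (hQ : IsStationaryLaw Q)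
    {m : ℝ × ℝ → ℝ} (hm : Measurable m) (hm_add : ∀ a b t, m (a + t, b + t) = m (a, b) + t)
    {w : ℝ → ℝ≥0∞} (hw : Measurable w) :
    ∫⁻ S, ∑' c : S.gaps, (m ⁻¹' Ico 0 1).indicator (fun c => w (c.2 - c.1)) (c : ℝ × ℝ) ∂Q =
      ∫⁻ S, w (S.firstGT 0 - S.lastLE 0) / ENNReal.ofReal (S.firstGT 0 - S.lastLE 0) ∂Q := by
  let f : ℝ × ℝ → ℝ≥0∞ := (m ⁻¹' Ico 0 1).indicator fun c => w (c.2 - c.1)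
  have hf : Measurable f :=
    (hw.comp (measurable_snd.sub measurable_fst)).indicator (hm measurableSet_Ico)
  let F : LinePattern × ℝ → ℝ≥0∞ := fun q => f (q.1.lastLE q.2, q.1.firstGT q.2) /
      ENNReal.ofReal (q.1.firstGT q.2 - q.1.lastLE q.2)
  have hF : Measurable F := LinePattern.measurable_gap_integrand hf
  have hfadd : ∀ a b t, f (a + t, b + t) =
      (Ico (0 : ℝ) 1).indicator (fun _ => w (b - a)) (m (a, b) + t) := fun a b t => by
    simp only [f, indicator, mem_preimage, hm_add, add_sub_add_right_eq_sub]
  -- `F₀ (S, t)` is the value of `F (·, t)` at the shifted pattern `S + t`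
  let F₀ : LinePattern × ℝ → ℝ≥0∞ := fun q => (Ico (0 : ℝ) 1).indicator
      (fun _ => w (q.1.firstGT 0 - q.1.lastLE 0)) (m (q.1.lastLE 0, q.1.firstGT 0) + q.2) /
    ENNReal.ofReal (q.1.firstGT 0 - q.1.lastLE 0)
  have hF₀ : ∀ S t, F (S.translate t, t) = F₀ (S, t) := fun S t => by
    have h := S.translate_lastLE_firstGT t 0
    rw [zero_add] at h
    simp only [F, F₀, h.1, h.2, hfadd, add_sub_add_right_eq_sub]
  have hp : Measurable fun q : LinePattern × ℝ => q.1.lastLE 0 :=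
    LinePattern.measurable_lastLE.comp (measurable_fst.prodMk measurable_const)
  have hn : Measurable fun q : LinePattern × ℝ => q.1.firstGT 0 :=
    LinePattern.measurable_firstGT.comp (measurable_fst.prodMk measurable_const)
  have hF₀m : Measurable F₀ :=
    ((hw.comp (hn.sub hp)).indicator
      (((hm.comp (hp.prodMk hn)).add measurable_snd) measurableSet_Ico)).div
      (hn.sub hp).ennreal_ofReal
  calc ∫⁻ S, ∑' c : S.gaps, f c ∂Q = ∫⁻ S, (∫⁻ t, F (S, t)) ∂Q := by
        simp_rw [LinePattern.tsum_gaps]; rfl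
    _ = ∫⁻ t, ∫⁻ S, F (S, t) ∂Q := lintegral_lintegral_swap hF.aemeasurable
    _ = ∫⁻ t, ∫⁻ S, F₀ (S, t) ∂Q := by
        refine lintegral_congr fun t => ?_
        simp_rw [← hF₀]
        conv_lhs => rw [← IsStationaryLaw.map_translate hQ t]
        exact lintegral_map (hF.comp measurable_prodMk_right) (LinePattern.measurable_translate t)
    _ = ∫⁻ S, (∫⁻ t, F₀ (S, t)) ∂Q := (lintegral_lintegral_swap hF₀m.aemeasurable).symm
    _ = _ := by
        refine lintegral_congr fun S => ?_
        refine (lintegral_add_left_eq_self (μ := volume) (fun t => (Ico (0 : ℝ) 1).indicator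
          (fun _ => w (S.firstGT 0 - S.lastLE 0)) t / ENNReal.ofReal (S.firstGT 0 - S.lastLE 0))
          (m (S.lastLE 0, S.firstGT 0))).trans ?_
        simp_rw [div_eq_mul_inv]
        rw [lintegral_mul_const _ (measurable_const.indicator measurableSet_Ico),
          lintegral_indicator_const measurableSet_Ico, Real.volume_Ico]
        simp

/-- Gaps may be counted by their midpoints: their intensity is that of the points. -/
theorem IsStationaryLaw.lintegral_card_midpoints [SFinite Q] (hQ : IsStationaryLaw Q) :
    ∫⁻ S, ∑' c : S.gaps, {c : ℝ × ℝ | (c.1 + c.2) / 2 ∈ Ico (0 : ℝ) 1}.indicator 1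
      (c : ℝ × ℝ) ∂Q = lineIntensity Q := by
  have h1 := IsStationaryLaw.lintegral_tsum_gaps hQ (m := fun c => (c.1 + c.2) / 2) (by fun_prop)
    (fun a b t => by ring) (w := 1) measurable_one
  have h2 := IsStationaryLaw.lintegral_tsum_gaps hQ (m := Prod.fst) measurable_fst
    (fun a b t => rfl) (w := 1) measurable_one
  rw [lineIntensity]
  simp_rw [LinePattern.encard_points_inter]
  exact h1.trans h2.symm

/-- The gaps with midpoint in the unit interval have mean total length `1`. -/
theorem IsStationaryLaw.lintegral_length_midpoints [IsProbabilityMeasure Q]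
    (hQ : IsStationaryLaw Q) :
    ∫⁻ S, ∑' c : S.gaps, {c : ℝ × ℝ | (c.1 + c.2) / 2 ∈ Ico (0 : ℝ) 1}.indicator
      (fun c => ENNReal.ofReal (c.2 - c.1)) (c : ℝ × ℝ) ∂Q = 1 := by
  refine (IsStationaryLaw.lintegral_tsum_gaps hQ (m := fun c => (c.1 + c.2) / 2) (by fun_prop)
    (fun a b t => by ring) (w := ENNReal.ofReal) ENNReal.measurable_ofReal).trans ?_
  rw [lintegral_congr (g := fun _ => 1), lintegral_one, measure_univ]
  intro S
  refine ENNReal.div_self ?_ ENNReal.ofReal_ne_top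
  exact (ENNReal.ofReal_pos.2 (sub_pos.2 (S.consecutive_lastLE_firstGT 0).lt)).ne'

/-! ### Prisms -/

/-- The splitting of a point of space into its base point and its height. -/
def baseHeightEquiv : (Fin 3 → ℝ) ≃ᵐ (Fin 2 → ℝ) × ℝ :=
  (MeasurableEquiv.piFinSuccAbove (fun _ => ℝ) (2 : Fin 3)).trans MeasurableEquiv.prodComm

theorem baseHeightEquiv_apply (x : Fin 3 → ℝ) : baseHeightEquiv x = (basePt x, x 2) := by
  refine Prod.ext (funext fun i => ?_) rfl
  fin_cases i <;> rfl

theorem measurePreserving_baseHeightEquiv : MeasurePreserving baseHeightEquiv :=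
  Measure.measurePreserving_swap.comp (volume_preserving_piFinSuccAbove (fun _ => ℝ) (2 : Fin 3))

theorem coe_prism {z : Cell 2} {a b : ℝ} (hab : a ≤ b) :
    (prism z a b hab : Set (Fin 3 → ℝ)) =
      baseHeightEquiv ⁻¹' ((z : Set (Fin 2 → ℝ)) ×ˢ Icc a b) := by
  ext x
  rw [mem_prism, mem_preimage, baseHeightEquiv_apply]
  rfl

theorem volume_prism (z : Cell 2) {a b : ℝ} (hab : a ≤ b) :
    volume (prism z a b hab : Set (Fin 3 → ℝ)) =
      volume (z : Set (Fin 2 → ℝ)) * ENNReal.ofReal (b - a) := by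
  rw [coe_prism, measurePreserving_baseHeightEquiv.measure_preimage_equiv, Measure.volume_eq_prod,
    Measure.prod_prod, Real.volume_Icc]

theorem setIntegral_prism (z : Cell 2) {a b : ℝ} (hab : a ≤ b) (f : (Fin 2 → ℝ) → ℝ) (g : ℝ → ℝ) :
    ∫ x in (prism z a b hab : Set (Fin 3 → ℝ)), f (basePt x) * g (x 2) =
      (∫ y in (z : Set (Fin 2 → ℝ)), f y) * ∫ t in a..b, g t := by
  rw [intervalIntegral.integral_of_le hab, ← integral_Icc_eq_integral_Ioc, ← setIntegral_prod_mul,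
    coe_prism, ← Measure.volume_eq_prod,
    ← measurePreserving_baseHeightEquiv.setIntegral_preimage_emb
      baseHeightEquiv.measurableEmbedding]
  simp_rw [baseHeightEquiv_apply]

theorem centroid_prism {z : Cell 2} (hz : (interior (z : Set (Fin 2 → ℝ))).Nonempty) {a b : ℝ}
    (hab : a < b) :
    basePt (prism z a b hab.le).centroid = z.centroid ∧
      (prism z a b hab.le).centroid 2 = (a + b) / 2 := by
  have hv := Cell.volume_real_pos hz
  have hba : b - a ≠ 0 := (sub_pos.2 hab).ne'
  have hV : volume.real (prism z a b hab.le : Set (Fin 3 → ℝ)) =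
      volume.real (z : Set (Fin 2 → ℝ)) * (b - a) := by
    rw [Measure.real, volume_prism, ENNReal.toReal_mul,
      ENNReal.toReal_ofReal (sub_pos.2 hab).le, Measure.real]
  have h2 : (prism z a b hab.le).centroid 2 = (a + b) / 2 := by
    have h := setIntegral_prism z hab.le (fun _ => 1) fun t => t
    simp only [one_mul, setIntegral_const, smul_eq_mul, mul_one, integral_id] at h
    rw [Cell.centroid_apply, h, hV]
    field_simp
    ring
  have h1 : ∀ i : Fin 2, basePt (prism z a b hab.le).centroid i = z.centroid i := by
    intro i
    have h := setIntegral_prism z hab.le (fun y => y i) fun _ => 1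
    simp only [mul_one, intervalIntegral.integral_const, smul_eq_mul] at h
    have e : basePt (prism z a b hab.le).centroid i =
        (volume.real (prism z a b hab.le : Set (Fin 3 → ℝ)))⁻¹ *
          ∫ x in (prism z a b hab.le : Set (Fin 3 → ℝ)), basePt x i := by
      fin_cases i
      · exact Cell.centroid_apply _ 0
      · exact Cell.centroid_apply _ 1
    rw [e, h, hV, Cell.centroid_apply]
    field_simp
  exact ⟨funext h1, h2⟩

theorem centroid_prism_mem_unitCube {z : Cell 2}
    (hz : (interior (z : Set (Fin 2 → ℝ))).Nonempty) {a b : ℝ} (hab : a < b) :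
    (prism z a b hab.le).centroid ∈ unitCube 3 ↔
      z.centroid ∈ unitCube 2 ∧ (a + b) / 2 ∈ Ico (0 : ℝ) 1 := by
  obtain ⟨h1, h2⟩ := centroid_prism hz hab
  rw [← h1, ← h2]
  constructor
  · intro h
    refine ⟨fun i => ?_, h 2⟩
    fin_cases i
    · exact h 0
    · exact h 1
  · rintro ⟨h, h'⟩ i
    fin_cases i
    · exact h 0
    · exact h 1
    · exact h'

theorem prism_injective {z w : Cell 2} {a b c e : ℝ} (hab : a ≤ b) (hce : c ≤ e)
    (h : prism z a b hab = prism w c e hce) : z = w ∧ a = c ∧ b = e := by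
  have hm : ∀ y t, y ∈ z ∧ t ∈ Icc a b ↔ y ∈ w ∧ t ∈ Icc c e := fun y t => by
    have h1 := mem_prism (z := z) (hab := hab) (x := liftPt (y, t))
    have h2 := mem_prism (z := w) (hab := hce) (x := liftPt (y, t))
    rw [basePt_liftPt, height_liftPt] at h1 h2
    rw [← h1, ← h2, h]
  obtain ⟨y, hy⟩ := z.nonempty
  have hac := (hm y a).1 ⟨hy, left_mem_Icc.2 hab⟩
  have hbe := (hm y b).1 ⟨hy, right_mem_Icc.2 hab⟩
  have hca := (hm y c).2 ⟨hac.1, left_mem_Icc.2 hce⟩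
  have heb := (hm y e).2 ⟨hac.1, right_mem_Icc.2 hce⟩
  refine ⟨SetLike.ext fun u => ?_, le_antisymm hca.2.1 hac.2.1, le_antisymm hbe.2.2 heb.2.2⟩
  exact ⟨fun hu => ((hm u a).1 ⟨hu, left_mem_Icc.2 hab⟩).1,
    fun hu => ((hm u c).2 ⟨hu, left_mem_Icc.2 hce⟩).1⟩

/-! ### Sums over the cells of a column tessellation -/

theorem tsum_columnTessellation (φ : Tessellation 2) (S : Cell 2 → LinePattern)
    (H : Cell 3 → ℝ≥0∞) :
    ∑' Z : (columnTessellation φ S).cells, H Z =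
      ∑' z : φ.cells, ∑' c : (S z).gaps,
        H (prism z (c : ℝ × ℝ).1 (c : ℝ × ℝ).2 (LinePattern.consecutive_gap c).lt.le) := by
  let e : (Σ z : φ.cells, (S z).gaps) → (columnTessellation φ S).cells := fun p =>
    ⟨prism p.1 (p.2 : ℝ × ℝ).1 (p.2 : ℝ × ℝ).2 (LinePattern.consecutive_gap p.2).lt.le,
      p.1, p.1.2, _, _, p.2.2, rfl⟩
  have he : Function.Bijective e := by
    constructor
    · rintro ⟨⟨z, hz⟩, ⟨⟨a, b⟩, hc⟩⟩ ⟨⟨z', hz'⟩, ⟨⟨a', b'⟩, hc'⟩⟩ h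
      obtain ⟨h1, h2, h3⟩ := prism_injective (LinePattern.consecutive_gap _).lt.le
        (LinePattern.consecutive_gap _).lt.le (congrArg Subtype.val h)
      dsimp only at h1 h2 h3
      subst h1 h2 h3
      rfl
    · rintro ⟨_, z, hz, a, b, hc, rfl⟩
      exact ⟨⟨⟨z, hz⟩, ⟨(a, b), hc⟩⟩, rfl⟩
  rw [← (Equiv.ofBijective e he).tsum_eq]
  exact ENNReal.tsum_sigma fun (z : φ.cells) (c : (S z).gaps) =>
    H (prism z (c : ℝ × ℝ).1 (c : ℝ × ℝ).2 (LinePattern.consecutive_gap c).lt.le)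

/-- For a quantity that is a product of a base and a height part, the sum over the prisms with
centroid in the unit cube splits into the columns. -/
theorem tsum_columnTessellation_unitCube (φ : Tessellation 2) (S : Cell 2 → LinePattern)
    {H : Cell 3 → ℝ≥0∞} {v : Cell 2 → ℝ≥0∞} {w : ℝ × ℝ → ℝ≥0∞}
    (hH : ∀ z a b, ∀ hab : a < b, H (prism z a b hab.le) = v z * w (a, b)) :
    ∑' Z : (columnTessellation φ S).cells, {Z : Cell 3 | Z.centroid ∈ unitCube 3}.indicator H Z =
      ∑' z : φ.cells, {z : Cell 2 | z.centroid ∈ unitCube 2}.indicator v z *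
        ∑' c : (S z).gaps, {c : ℝ × ℝ | (c.1 + c.2) / 2 ∈ Ico (0 : ℝ) 1}.indicator w c := by
  rw [tsum_columnTessellation]
  refine tsum_congr fun z => ?_
  rw [← ENNReal.tsum_mul_left]
  refine tsum_congr fun c => ?_
  have hc := LinePattern.consecutive_gap c
  have hiff := centroid_prism_mem_unitCube (φ.interior_nonempty z z.2) hc.lt
  simp only [indicator, mem_ofPred_eq, hiff, hH _ _ _ hc.lt]
  split_ifs <;> simp_all

theorem tsum_subtype_and {α : Type*} (s : Set α) (p : α → Prop) (f : α → ℝ≥0∞) :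
    ∑' z : {z // z ∈ s ∧ p z}, f z = ∑' z : s, {z | p z}.indicator f z := by
  rw [tsum_subtype s, indicator_indicator, ← tsum_subtype]
  rfl

theorem cellIntensity_eq {Ω : Type*} [MeasurableSpace Ω] (P : Measure Ω) {d : ℕ}
    (X : Ω → Tessellation d) :
    cellIntensity P X = ∫⁻ ω, ∑' z : (X ω).cells,
      {z : Cell d | z.centroid ∈ unitCube d}.indicator 1 (z : Cell d) ∂P := by
  refine lintegral_congr fun ω => ?_
  rw [← ENNReal.tsum_set_one]
  exact tsum_subtype_and (X ω).cells (fun z => z.centroid ∈ unitCube d) 1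

theorem cellIntensity_mul_typicalCellMean {Ω : Type*} [MeasurableSpace Ω] {P : Measure Ω} {d : ℕ}
    {X : Ω → Tessellation d} (h0 : cellIntensity P X ≠ 0) (ht : cellIntensity P X ≠ ⊤)
    {h : Tessellation d → Cell d → ℝ≥0∞}
    (hcov : ∀ x φ, ∀ z ∈ φ.cells, h (φ.translate x) (z.translate x) = h φ z) :
    cellIntensity P X * typicalCellMean P X h = ∫⁻ ω, ∑' z : (X ω).cells,
      {z : Cell d | z.centroid ∈ unitCube d}.indicator (h (X ω)) z ∂P := by
  rw [typicalCellMean, ← mul_assoc, ENNReal.mul_inv_cancel h0 ht, one_mul]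
  refine lintegral_congr fun ω => ?_
  rw [← tsum_subtype_and]
  exact tsum_congr fun z => hcov _ _ _ z.2.1

/-! ### Conditioning on the planar tessellation -/

variable {Ω : Type*} [MeasurableSpace Ω] {P : Measure Ω} {Y' : Ω → Tessellation 2}
  {κ : Kernel (Tessellation 2 × Cell 2) LinePattern} {cuts : Ω → Cell 2 → LinePattern}

/-- Given the planar tessellation, the point process over its `n`-th cell may be averaged out. Since
means are additive over the cells, the joint conditional law of several columns does not enter. -/
theorem lintegral_mul_cuts [IsProbabilityMeasure P] [IsMarkovKernel κ] (hY' : Measurable Y')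
    {label : ℕ → Tessellation 2 → Cell 2} {n : ℕ} (hl : Measurable (label n))
    (hc : Measurable fun ω => cuts ω (label n (Y' ω)))
    (hlaw : ∀ (G : Set (Tessellation 2)) (A : Set LinePattern), MeasurableSet G → MeasurableSet A →
      P {ω | Y' ω ∈ G ∧ cuts ω (label n (Y' ω)) ∈ A} =
        ∫⁻ ω in {ω | Y' ω ∈ G}, κ (Y' ω, label n (Y' ω)) A ∂P)
    {f : Tessellation 2 → ℝ≥0∞} (hf : Measurable f) {g : LinePattern → ℝ≥0∞} (hg : Measurable g) :
    ∫⁻ ω, f (Y' ω) * g (cuts ω (label n (Y' ω))) ∂P =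
      ∫⁻ ω, f (Y' ω) * ∫⁻ S, g S ∂κ (Y' ω, label n (Y' ω)) ∂P := by
  have hid : Measurable fun φ : Tessellation 2 => (φ, label n φ) := measurable_id.prodMk hl
  let η : Kernel (Tessellation 2) LinePattern := κ.comap _ hid
  have hprob : IsProbabilityMeasure (P.map Y') := Measure.isProbabilityMeasure_map hY'.aemeasurable
  have hpair : Measurable fun ω => (Y' ω, cuts ω (label n (Y' ω))) := hY'.prodMk hc
  have hjoint : P.map (fun ω => (Y' ω, cuts ω (label n (Y' ω)))) = (P.map Y') ⊗ₘ η := by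
    have : IsProbabilityMeasure (P.map fun ω => (Y' ω, cuts ω (label n (Y' ω)))) :=
      Measure.isProbabilityMeasure_map hpair.aemeasurable
    refine Measure.ext_prod fun {G A} hG hA => ?_
    rw [Measure.map_apply hpair (hG.prod hA), Measure.compProd_apply_prod hG hA,
      setLIntegral_map hG (η.measurable_coe hA) hY']
    exact hlaw G A hG hA
  have hF : Measurable fun q : Tessellation 2 × LinePattern => f q.1 * g q.2 :=
    (hf.comp measurable_fst).mul (hg.comp measurable_snd)
  rw [← lintegral_map (f := fun q : Tessellation 2 × LinePattern => f q.1 * g q.2) hF hpair,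
    hjoint, Measure.lintegral_compProd hF]
  simp_rw [lintegral_const_mul _ hg]
  exact lintegral_map (hf.mul hg.lintegral_kernel) hY'

/-- In each column the mean over the gaps, given the planar tessellation, may be replaced by its
conditional value `r`. -/
theorem CondIndepCuts.lintegral_tsum_columnTessellation [IsProbabilityMeasure P] [IsMarkovKernel κ]
    (hcuts : CondIndepCuts P Y' κ cuts) (hY' : Measurable Y') {H : Cell 3 → ℝ≥0∞}
    {v : Cell 2 → ℝ≥0∞} (hv : Measurable v) {w : ℝ × ℝ → ℝ≥0∞} (hw : Measurable w)
    (hH : ∀ z a b, ∀ hab : a < b, H (prism z a b hab.le) = v z * w (a, b))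
    {r : Tessellation 2 → Cell 2 → ℝ≥0∞}
    (hr : ∀ φ : Tessellation 2, ∀ z ∈ φ.cells, ∫⁻ S, ∑' c : S.gaps,
      {c : ℝ × ℝ | (c.1 + c.2) / 2 ∈ Ico (0 : ℝ) 1}.indicator w (c : ℝ × ℝ) ∂κ (φ, z) = r φ z) :
    ∫⁻ ω, ∑' Z : (columnTessellation (Y' ω) (cuts ω)).cells,
        {Z : Cell 3 | Z.centroid ∈ unitCube 3}.indicator H (Z : Cell 3) ∂P =
      ∫⁻ ω, ∑' z : (Y' ω).cells, {z : Cell 2 | z.centroid ∈ unitCube 2}.indicator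
        (fun z => v z * r (Y' ω) z) (z : Cell 2) ∂P := by
  obtain ⟨label, hlm, hlb, hcm, hlaw⟩ := hcuts
  have hl : IsLabelling label := ⟨hlm, fun φ => (hlb φ).1, fun φ => (hlb φ).2⟩
  let u : Cell 2 → ℝ≥0∞ := {z : Cell 2 | z.centroid ∈ unitCube 2}.indicator v
  have hu : Measurable u := hv.indicator (measurable_centroid 2 (measurableSet_unitCube 2))
  let g : LinePattern → ℝ≥0∞ := fun S => ∑' c : S.gaps,
    {c : ℝ × ℝ | (c.1 + c.2) / 2 ∈ Ico (0 : ℝ) 1}.indicator w (c : ℝ × ℝ)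
  have hg : Measurable g := LinePattern.measurable_tsum_gaps (hw.indicator
    (measurableSet_Ico.preimage (f := fun c : ℝ × ℝ => (c.1 + c.2) / 2) (by fun_prop)))
  have hid : ∀ n, Measurable fun ω => (Y' ω, label n (Y' ω)) := fun n =>
    hY'.prodMk ((hlm n).comp hY')
  calc ∫⁻ ω, ∑' Z : (columnTessellation (Y' ω) (cuts ω)).cells,
        {Z : Cell 3 | Z.centroid ∈ unitCube 3}.indicator H (Z : Cell 3) ∂P
      = ∫⁻ ω, ∑' n, u (label n (Y' ω)) * g (cuts ω (label n (Y' ω))) ∂P := by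
        refine lintegral_congr fun ω => ?_
        rw [tsum_columnTessellation_unitCube (Y' ω) (cuts ω) hH]
        exact hl.tsum_cells (Y' ω) fun z => u z * g (cuts ω z)
    _ = ∑' n, ∫⁻ ω, u (label n (Y' ω)) * g (cuts ω (label n (Y' ω))) ∂P :=
        lintegral_tsum fun n =>
          ((hu.comp ((hlm n).comp hY')).mul (hg.comp (hcm n))).aemeasurable
    _ = ∑' n, ∫⁻ ω, u (label n (Y' ω)) * ∫⁻ S, g S ∂κ (Y' ω, label n (Y' ω)) ∂P := by
        refine tsum_congr fun n => ?_
        refine lintegral_mul_cuts hY' (hlm n) (hcm n) (fun G A hG hA => ?_)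
          (f := fun φ => u (label n φ)) (hu.comp (hlm n)) hg
        simpa using hlaw G {n} (fun _ => A) hG fun _ => hA
    _ = ∫⁻ ω, ∑' n, u (label n (Y' ω)) * ∫⁻ S, g S ∂κ (Y' ω, label n (Y' ω)) ∂P :=
        (lintegral_tsum fun n => ((hu.comp ((hlm n).comp hY')).mul
          (hg.lintegral_kernel.comp (hid n))).aemeasurable).symm
    _ = _ := by
        refine lintegral_congr fun ω => ?_
        rw [← hl.tsum_cells (Y' ω) fun z => u z * ∫⁻ S, g S ∂κ (Y' ω, z)]
        refine tsum_congr fun z => ?_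
        rw [hr _ _ z.2]
        simp only [u, indicator]
        split_ifs <;> simp

end ColumnTess

theorem mainTheorem7 {Ω : Type*} [MeasurableSpace Ω] (P : Measure Ω) [IsProbabilityMeasure P]
    -- the stationary planar tessellation
    (Y' : Ω → Tessellation 2) (hY'_meas : Measurable Y') (hY'_stat : IsStationaryTessellation P Y')
    -- the marks of its cells, a translation covariant function of the tessellation
    (ρ : Tessellation 2 → Cell 2 → ℝ≥0) (hρ_meas : Measurable fun p : Tessellation 2 × Cell 2 => ρ p.1 p.2)
    (hρ_pos : ∀ φ : Tessellation 2, ∀ z ∈ φ.cells, 0 < ρ φ z)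
    (hρ_cov : ∀ (x : Fin 2 → ℝ) (φ : Tessellation 2), ∀ z ∈ φ.cells,
      ρ (φ.translate x) (z.translate x) = ρ φ z)
    -- the conditional laws of the point processes on the vertical lines
    (κ : Kernel (Tessellation 2 × Cell 2) LinePattern) [IsMarkovKernel κ]
    (hκ_stat : ∀ φ : Tessellation 2, ∀ z ∈ φ.cells, IsStationaryLaw (κ (φ, z)))
    (hκ_int : ∀ φ : Tessellation 2, ∀ z ∈ φ.cells, lineIntensity (κ (φ, z)) = ρ φ z)
    (hκ_cov : ∀ (x : Fin 2 → ℝ) (φ : Tessellation 2), ∀ z ∈ φ.cells,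
      κ (φ.translate x, z.translate x) = κ (φ, z))
    -- the point processes themselves, and the column tessellation
    (cuts : Ω → Cell 2 → LinePattern) (hcuts : CondIndepCuts P Y' κ cuts)
    (Y : Ω → Tessellation 3) (hY : ∀ ω, Y ω = columnTessellation (Y' ω) (cuts ω))
    -- the intensities of planar and spatial cells are positive and finite
    (hplanar : 0 < cellIntensity P Y' ∧ cellIntensity P Y' < ⊤)
    (hspatial : 0 < cellIntensity P Y ∧ cellIntensity P Y < ⊤) :
    cellIntensity P Y * meanCellVolume P Y = 1 ∧
    meanCellVolume P Y =
      1 / (cellIntensity P Y' * typicalCellMean P Y' (fun φ z => (ρ φ z : ℝ≥0∞))) := by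
  have hYeq : Y = fun ω => columnTessellation (Y' ω) (cuts ω) := funext hY
  have hvol : cellIntensity P Y * meanCellVolume P Y = 1 := by
    rw [meanCellVolume, cellIntensity_mul_typicalCellMean hspatial.1.ne' hspatial.2.ne
      fun x _ z _ => Cell.volume_translate x z, hYeq]
    rw [hcuts.lintegral_tsum_columnTessellation hY'_meas (measurable_cell_volume 2)
      (w := fun c => ENNReal.ofReal (c.2 - c.1)) (by fun_prop)
      (fun z a b hab => volume_prism z hab.le) (r := fun _ _ => 1)
      fun φ z hz => IsStationaryLaw.lintegral_length_midpoints (hκ_stat φ z hz)]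
    obtain ⟨label, hlm, hlb, -, -⟩ := hcuts
    simp_rw [mul_one]
    exact IsStationaryTessellation.lintegral_tsum_volume hY'_stat hY'_meas
      ⟨hlm, fun φ => (hlb φ).1, fun φ => (hlb φ).2⟩
  have hint : cellIntensity P Y =
      cellIntensity P Y' * typicalCellMean P Y' (fun φ z => (ρ φ z : ℝ≥0∞)) := by
    rw [cellIntensity_mul_typicalCellMean hplanar.1.ne' hplanar.2.ne
      fun x φ z hz => by rw [hρ_cov x φ z hz], cellIntensity_eq, hYeq]
    rw [hcuts.lintegral_tsum_columnTessellation hY'_meas (v := 1) measurable_one (w := 1)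
      measurable_one (fun z a b hab => by simp) (r := fun φ z => (ρ φ z : ℝ≥0∞))
      fun φ z hz => (IsStationaryLaw.lintegral_card_midpoints (hκ_stat φ z hz)).trans
        (hκ_int φ z hz)]
    simp_rw [Pi.one_apply, one_mul]
  refine ⟨hvol, ?_⟩
  rw [← hint, one_div]
  exact ENNReal.eq_inv_of_mul_eq_one_left (by rw [mul_comm, hvol])
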